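/- **Definitions.** A hyper arc diagram with $m\ge 0$ legs is a permutation $\alpha\in\mathbb S_m$ of the legs $1,\dots,m$, which are placed on an oriented line from left to right; its hyper arcs are the disjoint cycles of $\alpha$ (fixed points included), and the length of a hyper arc is its number of legs. A hyper chord diagram is a hyper arc diagram considered up to conjugation by powers of the standard cycle $\sigma=(1\,2\,\dots\,m)$. Concatenation places the second diagram to the right of the first. To erase a leg $p$ means to replace the arcs $x\to p\to y$ by one arc $x\to y$ (a fixed point $p$ simply disappears) and to renumber the other legs in their order. The *universal $\mathfrak{gl}$-weight system* is the function $w_{\mathfrak{gl}}$ on hyper arc diagrams with values in $\mathbb C[N,C_1,C_2,\dots]$ determined by the following relations: 1. $w_{\mathfrak{gl}}$ is multiplicative with respect to concatenation; 2. $w_{\mathfrak{gl}}((1\,2\,\dots\,m))=C_m$ for all $m\ge1$; 3. for $\alpha\in\mathbb S_m$ and neighboring legs $k,k+1$, let $s=(k\ k{+}1)$. If $\alpha(k)\ne k+1$ and $\alpha(k+1)\neq k$, then $$w_{\mathfrak{gl}}(\alpha)-w_{\mathfrak{gl}}(s\alpha s)=w_{\mathfrak{gl}}(\beta_1)-w_{\mathfrak{gl}}(\beta_2),$$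 where $\beta_1,\beta_2\in\mathbb S_{m-1}$ are obtained from $\alpha s$ (first apply $s$, then $\alpha$) by erasing the leg $k+1$, respectively the leg $k$. If $\alpha(k+1)=k$ and $\alpha(k)\ne k+1$, then $$w_{\mathfrak{gl}}(\alpha)-w_{\mathfrak{gl}}(s\alpha s)=C_1\,w_{\mathfrak{gl}}(\alpha'')-N\,w_{\mathfrak{gl}}(\alpha'),$$ where $\alpha'$ is $\alpha$ with the leg $k+1$ erased and $\alpha''$ is $\alpha$ with both legs $k,k+1$ erased. *Generalized Vassiliev relations.* Fix all legs on the line except one leg (the free leg); the cyclic structure of the hyper arcs, including the hyper arc containing the free leg, is kept. For a fixed leg $j$ and a function $f$ on hyper arc diagrams let $\Delta_j f$ be the value of $f$ with the free leg placed immediately before $j$ minus its value with the free leg placed immediately after $j$. The *one-hyper-arc relation* is $\sum_j\Delta_jf=0$, the sum being over the fixed legs $j$ of the hyper arc that contains the free leg. The *two-hyper-arc relation* is $\sum_j\Delta_jf=0$, the sum being over all legs $j$ of a given hyper arc that does not contain the free leg. **Theorem.** The relations 1–3 determine a unique function $w_{\mathfrak{gl}}$. It is invariant under cyclic shifts, so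 that it is a function on hyper chord diagrams, and it satisfies all one-hyper-arc and all two-hyper-arc generalized Vassiliev relations. -/

import Mathlib

namespace HyperDiagram

/-- A hyper arc diagram with `m` legs is a pair `(σ, α)`, where `σ = (1 2 … m)` is the standard
long cycle and `α` is an arbitrary permutation of the `m` legs; it is recorded by `α`.
The legs are numbered from left to right by the elements of `Fin m`, and the hyper edges
(hyper arcs) are the cycles of `α`, fixed points included. -/
abbrev HyperArc (m : ℕ) : Type := Equiv.Perm (Fin m)

/-- Two hyper arc diagrams are equivalent if they differ by a cyclic shift of the legs, that is,
by conjugation by a power of the standard long cycle `finRotate m`. -/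
def cyclicSetoid (m : ℕ) : Setoid (HyperArc m) where
  r α β := ∃ i : ℤ, (finRotate m ^ i) * α * (finRotate m ^ i)⁻¹ = β
  iseqv :=
    { refl := fun α => ⟨0, by simp⟩
      symm := by
        rintro α β ⟨i, rfl⟩
        exact ⟨-i, by simp [mul_assoc]⟩
      trans := by
        rintro α β γ ⟨i, rfl⟩ ⟨j, rfl⟩
        exact ⟨j + i, by simp [zpow_add, mul_assoc]⟩ }

/-- Hyper chord diagrams with `m` legs: hyper arc diagrams up to cyclic shift. -/
def HyperChord (m : ℕ) : Type := Quotient (cyclicSetoid m)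

/-- The hyper chord diagram represented by a hyper arc diagram. -/
def HyperArc.toChord {m : ℕ} (α : HyperArc m) : HyperChord m := Quotient.mk (cyclicSetoid m) α

/-- The connected sum (concatenation): `β` is placed to the right of `α`. -/
def concat {m n : ℕ} (α : HyperArc m) (β : HyperArc n) : HyperArc (m + n) :=
  finSumFinEquiv.permCongr (Equiv.sumCongr α β)

/-- Erase the leg `p`: an arc `x → p` followed by an arc `p → y` is replaced by an arc `x → y`
(if `p` is a fixed point it just disappears), and the other legs are renumbered in their order. -/
def eraseLeg {n : ℕ} (p : Fin (n + 1)) (α : HyperArc (n + 1)) : HyperArc n :=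
  Equiv.removeNone (((finSuccEquiv' p).symm.trans α).trans (finSuccEquiv' p))

/-- The transposition of the neighbouring legs `k` and `k + 1`. -/
def adjSwap {n : ℕ} (k : Fin (n + 1)) : HyperArc (n + 2) := Equiv.swap k.castSucc k.succ

/-- The names of the variables `N, C₁, C₂, …`. -/
inductive GlVar : Type
  | N : GlVar
  | C (m : ℕ+) : GlVar

/-- The ring `ℂ[N, C₁, C₂, …]` of polynomials in infinitely many variables. -/
abbrev GlPoly : Type := MvPolynomial GlVar ℂ

/-- The defining relations of the universal `gl`-weight system, a function on the hyper arc
diagrams with any number of legs. -/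
structure IsUniversalGlWeightSystem (w : ∀ m : ℕ, HyperArc m → GlPoly) : Prop where
  /-- Multiplicativity with respect to the concatenation. -/
  concat_eq : ∀ (m n : ℕ) (α : HyperArc m) (β : HyperArc n),
    w (m + n) (concat α β) = w m α * w n β
  /-- The value on the standard cycle `1 → 2 → ⋯ → m → 1` is `C_m`. -/
  cycle_eq : ∀ m : ℕ+, w m (finRotate m) = MvPolynomial.X (GlVar.C m)
  /-- The recurrence relation for two neighbouring legs `k, k + 1` that are not joined by an arc.
  Write `α` as `a → k + 1 → b`, `d → k → c`. The second diagram on the left is obtained by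
  exchanging the legs: `a → k → b`, `d → k + 1 → c`. In the diagrams on the right the two legs are
  replaced by a single one: `d → k → b`, `a → c` in the first, `a → k → c`, `d → b` in the second;
  these arise from `α * adjSwap k` (which is `d → k → b`, `a → k + 1 → c`) by erasing
  `k + 1` and `k`, respectively. -/
  recurrence : ∀ (n : ℕ) (α : HyperArc (n + 2)) (k : Fin (n + 1)),
    α k.castSucc ≠ k.succ → α k.succ ≠ k.castSucc →
    w (n + 2) α - w (n + 2) (adjSwap k * α * adjSwap k) =
      w (n + 1) (eraseLeg k.succ (α * adjSwap k)) -
        w (n + 1) (eraseLeg k.castSucc (α * adjSwap k))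
  /-- The exceptional form of the recurrence relation for `a → k + 1 → k → b`: on the right
  stand `C₁` times the diagram with `a → b` (both legs erased) and `N` times the diagram with
  `a → k → b`. The case in which `α` also contains the arc `k → k + 1` is left out: there the two
  diagrams on the left coincide. The case of an arc `k → k + 1` alone is this one, read for
  the second diagram on the left. -/
  recurrence_exceptional : ∀ (n : ℕ) (α : HyperArc (n + 2)) (k : Fin (n + 1)),
    α k.castSucc ≠ k.succ → α k.succ = k.castSucc →
    w (n + 2) α - w (n + 2) (adjSwap k * α * adjSwap k) =
      MvPolynomial.X (GlVar.C 1) * w n (eraseLeg k (eraseLeg k.succ α)) -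
        MvPolynomial.X GlVar.N * w (n + 1) (eraseLeg k.succ α)

/-- Data for the generalized Vassiliev relations: `n` fixed legs, which stand on the line in the
order of `Fin n`, and one free leg `none`, whose place on the line is not yet chosen; the hyper
edges are the cycles of the permutation `τ`. `placeFree τ p` is the hyper arc diagram in which the
free leg has taken the place number `p` among the `n + 1` legs. -/
def placeFree {n : ℕ} (τ : Equiv.Perm (Option (Fin n))) (p : Fin (n + 1)) : HyperArc (n + 1) :=
  (finSuccEquiv' p).symm.permCongr τ

/-- The term of the relation contributed by a fixed leg `j`: the value for the free leg
immediately before `j` minus the value for the free leg immediately after `j`. -/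
def legDifference {R : Type*} [AddCommGroup R] (f : ∀ m : ℕ, HyperArc m → R) {n : ℕ}
    (τ : Equiv.Perm (Option (Fin n))) (j : Fin n) : R :=
  f (n + 1) (placeFree τ j.castSucc) - f (n + 1) (placeFree τ j.succ)

open Classical in
/-- The one-hyper-arc Vassiliev relations: the free leg takes all positions next to the other
(fixed) legs of the hyper arc it belongs to. -/
def OneHyperArcRelations {R : Type*} [AddCommGroup R] (f : ∀ m : ℕ, HyperArc m → R) : Prop :=
  ∀ (n : ℕ) (τ : Equiv.Perm (Option (Fin n))),
    ∑ j : Fin n with τ.SameCycle none (some j), legDifference f τ j = 0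

open Classical in
/-- The two-hyper-arc Vassiliev relations: the free leg takes all positions next to the legs of
a hyper arc (the one through the fixed leg `i`) to which it does not belong. -/
def TwoHyperArcRelations {R : Type*} [AddCommGroup R] (f : ∀ m : ℕ, HyperArc m → R) : Prop :=
  ∀ (n : ℕ) (τ : Equiv.Perm (Option (Fin n))) (i : Fin n), ¬ τ.SameCycle none (some i) →
    ∑ j : Fin n with τ.SameCycle (some i) (some j), legDifference f τ j = 0

end HyperDiagram

/-! The relations follow from one rule without exceptions: the difference of a diagram and its
exchange equals two contractions of `α * s`, where erasing a fixed point costs a factor `ν = N`. If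
`α (k+1) = k`, then `α * s` fixes `k`; one contraction gives `N`, the other leaves a fixed leg worth
`C₁`.

Vassiliev relations: in this form each leg difference is `T j - T' j` with `T (τ x) = T' x`, so sums
over `τ`-invariant sets cancel. Summing over all legs gives invariance under rotation, and rotating
concatenations shows that all values commute, even in a noncommutative ring.

Existence: if `E i j` satisfy the `gl` relations, the sums over indices of products of `E (i l) (i
(α l))` obey the rule, because a commutator produces exactly the two contractions. Taking `E i j = t
y_ij + D_ij`, the top coefficient in `t` of the standard cycle is the trace of a power of the
generic matrix. Over all sizes `N` together these symbols separate polynomials in `N, C₁, C₂, …`, so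
evaluation at the standard cycles is injective. By induction every value lies in its image, and
pulling back gives `w`.

Uniqueness: exchanges, modulo fewer legs, reduce every diagram to a standard cycle or a
concatenation of smaller diagrams. -/

namespace HyperDiagram

/-! ### Erasing the free leg -/

section Option

variable {X : Type*}

theorem some_removeNone [DecidableEq X] (e : Equiv.Perm (Option X)) (x : X) :
    some (Equiv.removeNone e x) = if e (some x) = none then e none else e (some x) := by
  split_ifs with h
  · exact Equiv.removeNone_none e h
  · exact Equiv.removeNone_some e (Option.ne_none_iff_exists'.1 h)

theorem removeNone_swap_mul_of_apply_none [DecidableEq X] (τ : Equiv.Perm (Option X)) (x : X)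
    (h : τ none = some x) :
    Equiv.removeNone (Equiv.swap none (some x) * τ) = Equiv.removeNone τ := by
  ext y
  apply Option.some_injective
  have h1 : τ (some y) ≠ some x := fun h' => by simpa using τ.injective (h'.trans h.symm)
  simp only [some_removeNone, Equiv.Perm.mul_apply, Equiv.swap_apply_def]
  grind

theorem removeNone_mul_swap_of_apply_some [DecidableEq X] (τ : Equiv.Perm (Option X)) (x : X)
    (h : τ (some x) = none) :
    Equiv.removeNone (τ * Equiv.swap none (some x)) = Equiv.removeNone τ := by
  ext y
  apply Option.some_injective
  have h1 : ∀ z, τ z = none → z = some x := fun z h' => τ.injective (h'.trans h.symm)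
  simp only [some_removeNone, Equiv.Perm.mul_apply, Equiv.swap_apply_def]
  grind

/-- With `a → none → b` in `τ`, both sides replace the arcs by `a → y` and `x → b`. Together with
the two boundary cases above, this matches consecutive terms along a cycle. -/
theorem removeNone_swap_mul_eq_mul_swap [DecidableEq X] (τ : Equiv.Perm (Option X)) (x y : X)
    (h : τ (some x) = some y) :
    Equiv.removeNone (Equiv.swap none (some y) * τ) =
      Equiv.removeNone (τ * Equiv.swap none (some x)) := by
  ext z
  apply Option.some_injective
  have h1 : ∀ z, τ z = some y → z = some x := fun z h' => τ.injective (h'.trans h.symm)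
  simp only [some_removeNone, Equiv.Perm.mul_apply, Equiv.swap_apply_def]
  grind

end Option

/-! ### Placing, erasing and exchanging legs -/

theorem placeFree_apply_self {n : ℕ} (τ : Equiv.Perm (Option (Fin n))) (p : Fin (n + 1)) :
    placeFree τ p p = (finSuccEquiv' p).symm (τ none) := by
  simp [placeFree]

theorem eraseLeg_placeFree {n : ℕ} (τ : Equiv.Perm (Option (Fin n))) (p : Fin (n + 1)) :
    eraseLeg p (placeFree τ p) = Equiv.removeNone τ := by
  unfold eraseLeg
  congr 1
  ext x : 1
  simp [placeFree]

theorem placeFree_apply_self_eq_iff {n : ℕ} (τ : Equiv.Perm (Option (Fin n))) (p : Fin (n + 1)) :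
    placeFree τ p p = p ↔ τ none = none := by
  rw [placeFree_apply_self, Equiv.symm_apply_eq, finSuccEquiv'_at]

/-- Every hyper arc diagram arises by placing a free leg at a given position. -/
theorem exists_placeFree_eq {n : ℕ} (α : HyperArc (n + 1)) (p : Fin (n + 1)) :
    ∃ τ, placeFree τ p = α :=
  ⟨(finSuccEquiv' p).permCongr α, by ext x; simp [placeFree]⟩

theorem succAbove_eraseLeg {n : ℕ} (p : Fin (n + 1)) (σ : HyperArc (n + 1)) (l : Fin n) :
    p.succAbove (eraseLeg p σ l) =
      if σ (p.succAbove l) = p then σ p else σ (p.succAbove l) := by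
  have h := some_removeNone
    (((finSuccEquiv' p).symm.trans σ).trans (finSuccEquiv' p)) l
  have h2 := congrArg (finSuccEquiv' p).symm h
  simp only [finSuccEquiv'_symm_some, Equiv.trans_apply, finSuccEquiv'_symm_none] at h2
  unfold eraseLeg
  rw [h2]
  by_cases h3 : σ (p.succAbove l) = p
  · simp [h3]
  · have : finSuccEquiv' p (σ (p.succAbove l)) ≠ none := by
      rw [Ne, finSuccEquiv'_eq_none]; exact fun h => h3 h.symm
    simp [h3, this]

theorem placeFree_mul {n : ℕ} (τ ρ : Equiv.Perm (Option (Fin n))) (p : Fin (n + 1)) :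
    placeFree (τ * ρ) p = placeFree τ p * placeFree ρ p := by
  ext x; simp [placeFree]

theorem placeFree_swap {n : ℕ} (k : Fin (n + 1)) :
    placeFree (Equiv.swap none (some k)) k.castSucc = adjSwap k := by
  ext x : 1
  have : (finSuccEquiv' k.castSucc).symm (some k) = k.succ := by simp
  simp only [placeFree, adjSwap, Equiv.permCongr_apply]
  rw [Equiv.symm_symm, ← Equiv.trans_apply, ← Equiv.trans_apply, ← Equiv.trans_assoc]
  have h := Equiv.symm_trans_swap_trans none (some k) (finSuccEquiv' k.castSucc).symm
  rw [Equiv.symm_symm] at h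
  rw [h, this, finSuccEquiv'_symm_none]

theorem adjSwap_mul_self {n : ℕ} (k : Fin (n + 1)) : adjSwap k * adjSwap k = 1 :=
  Equiv.swap_mul_self _ _

theorem adjSwap_castSucc_succAbove {n : ℕ} (k l : Fin (n + 1)) :
    adjSwap k (k.castSucc.succAbove l) = k.succ.succAbove l := by
  rcases lt_trichotomy l k with h | rfl | h
  · have h' : (l : ℕ) < k := h
    rw [Fin.succAbove_of_castSucc_lt _ _ (Fin.castSucc_lt_castSucc_iff.2 h),
      Fin.succAbove_of_castSucc_lt _ _ (show (l : ℕ) < k + 1 by omega), adjSwap,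
      Equiv.swap_apply_of_ne_of_ne]
    · simpa using h.ne
    · intro h2
      have h3 : (l : ℕ) = k + 1 := congrArg Fin.val h2
      omega
  · simp [adjSwap]
  · have h' : (k : ℕ) < l := h
    rw [Fin.succAbove_of_le_castSucc _ _ (Fin.castSucc_le_castSucc_iff.2 h.le),
      Fin.succAbove_of_le_castSucc _ _ (show (k : ℕ) + 1 ≤ l by omega), adjSwap,
      Equiv.swap_apply_of_ne_of_ne]
    · intro h2
      have h3 : (l : ℕ) + 1 = k := congrArg Fin.val h2
      omega
    · simpa using h.ne'

theorem adjSwap_succ_succAbove {n : ℕ} (k l : Fin (n + 1)) :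
    adjSwap k (k.succ.succAbove l) = k.castSucc.succAbove l := by
  rw [← adjSwap_castSucc_succAbove, ← Equiv.Perm.mul_apply, adjSwap_mul_self, Equiv.Perm.one_apply]

/-- Turns a leg difference into the left-hand side of the exchange rule. -/
theorem placeFree_succ {n : ℕ} (τ : Equiv.Perm (Option (Fin (n + 1)))) (k : Fin (n + 1)) :
    placeFree τ k.succ = adjSwap k * placeFree τ k.castSucc * adjSwap k := by
  have key : ∀ x, adjSwap k ((finSuccEquiv' k.castSucc).symm x) = (finSuccEquiv' k.succ).symm x := by
    rintro (_ | l)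
    · simp [adjSwap]
    · simpa using adjSwap_castSucc_succAbove k l
  ext x : 1
  obtain ⟨y, rfl⟩ := (finSuccEquiv' k.succ).symm.surjective x
  rw [Equiv.Perm.mul_apply, Equiv.Perm.mul_apply, ← key y, ← Equiv.Perm.mul_apply (adjSwap k)
    (adjSwap k), adjSwap_mul_self, key]
  simp only [placeFree, Equiv.permCongr_apply, Equiv.symm_symm, Equiv.Perm.one_apply,
    Equiv.apply_symm_apply, key]

/-! ### Vassiliev relations and cyclic invariance -/

section ExchangeSystem

variable {A : Type*} [Ring A]

/-- The value of `W` after erasing the leg `p`, where a fixed point contributes the factor `ν`. -/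
def contraction (ν : A) (W : ∀ m : ℕ, HyperArc m → A) {n : ℕ} (p : Fin (n + 1))
    (σ : HyperArc (n + 1)) : A :=
  (if σ p = p then ν else 1) * W n (eraseLeg p σ)

/-- The relations of the `gl`-weight system in a form that needs no exceptional case; the values
may lie in a noncommutative ring. -/
structure IsExchangeSystem (ν : A) (W : ∀ m : ℕ, HyperArc m → A) : Prop where
  empty_eq : W 0 1 = 1
  concat_eq : ∀ (m n : ℕ) (α : HyperArc m) (β : HyperArc n),
    W (m + n) (concat α β) = W m α * W n β
  exchange : ∀ (n : ℕ) (α : HyperArc (n + 2)) (k : Fin (n + 1)),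
    W (n + 2) α - W (n + 2) (adjSwap k * α * adjSwap k) =
      contraction ν W k.succ (α * adjSwap k) - contraction ν W k.castSucc (α * adjSwap k)
  fixed_leg : ∀ (n : ℕ) (α : HyperArc (n + 1)) (p : Fin (n + 1)), α p = p →
    W (n + 1) α = W 1 1 * W n (eraseLeg p α)

/-- The contraction of the free leg. -/
def contractFree (ν : A) (W : ∀ m : ℕ, HyperArc m → A) {n : ℕ}
    (ρ : Equiv.Perm (Option (Fin n))) : A :=
  (if ρ none = none then ν else 1) * W n (Equiv.removeNone ρ)

theorem contraction_placeFree (ν : A) (W : ∀ m : ℕ, HyperArc m → A) {n : ℕ} (p : Fin (n + 1))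
    (ρ : Equiv.Perm (Option (Fin n))) :
    contraction ν W p (placeFree ρ p) = contractFree ν W ρ := by
  simp only [contraction, contractFree, eraseLeg_placeFree, placeFree_apply_self_eq_iff]

variable {ν : A} {W : ∀ m : ℕ, HyperArc m → A}

/-- Right multiplication by the exchange `s` is seen from position `j` as `τ * swap`. From position
`j + 1` it is seen as `swap * τ`, since `β * s = s * (s * β) * s`. -/
theorem IsExchangeSystem.legDifference_eq (hW : IsExchangeSystem ν W) {n : ℕ}
    (τ : Equiv.Perm (Option (Fin n))) (j : Fin n) :
    legDifference W τ j = contractFree ν W (Equiv.swap none (some j) * τ) -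
      contractFree ν W (τ * Equiv.swap none (some j)) := by
  cases n with
  | zero => exact j.elim0
  | succ n =>
    rw [legDifference, placeFree_succ, hW.exchange, ← contraction_placeFree ν W j.succ,
      ← contraction_placeFree ν W j.castSucc, placeFree_succ, placeFree_mul, placeFree_mul,
      placeFree_swap, ← mul_assoc, adjSwap_mul_self, one_mul]

/-- The free leg may be carried past any family of hyper arcs. -/
theorem IsExchangeSystem.sum_legDifference (hW : IsExchangeSystem ν W) {n : ℕ}
    (τ : Equiv.Perm (Option (Fin n))) (P : Option (Fin n) → Prop) [DecidablePred P]
    (hP : ∀ x, P (τ x) ↔ P x) :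
    ∑ j : Fin n with P (some j), legDifference W τ j = 0 := by
  -- The common value at `none` is chosen so that `T (τ x) = T' x` also holds where the cycle passes
  -- through the free leg.
  let T : Option (Fin n) → A := fun x => x.elim (ν * W n (Equiv.removeNone τ))
    fun j => contractFree ν W (Equiv.swap none (some j) * τ)
  let T' : Option (Fin n) → A := fun x => x.elim (ν * W n (Equiv.removeNone τ))
    fun j => contractFree ν W (τ * Equiv.swap none (some j))
  have key : ∀ x, T (τ x) = T' x := by
    rintro (_ | k)
    · rcases h : τ none with _ | j
      · rfl
      · simp [T, T', contractFree, h, removeNone_swap_mul_of_apply_none τ j h]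
    · rcases h : τ (some k) with _ | j
      · simp [T, T', contractFree, h, removeNone_mul_swap_of_apply_some τ k h]
      · have h1 : τ none ≠ some j := fun h' => by simpa using τ.injective (h'.trans h.symm)
        have h2 : (Equiv.swap none (some j)) (τ none) ≠ none := fun h' =>
          h1 ((Equiv.swap_apply_eq_iff.1 h').trans (Equiv.swap_apply_left _ _))
        simp only [T, T', contractFree, Option.elim_some,
          removeNone_swap_mul_eq_mul_swap τ k j h]
        congr 1
        rw [if_neg (by simpa using h2), if_neg (by simp [h])]
  have h0 : ∑ x, (if P x then T x else 0) = ∑ x, (if P x then T' x else 0) := by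
    rw [← Equiv.sum_comp τ]
    exact Finset.sum_congr rfl fun x _ => by simp only [hP, key]
  rw [Fintype.sum_option, Fintype.sum_option] at h0
  have h1 := add_left_cancel h0
  rw [Finset.sum_filter]
  refine Eq.trans ?_ (sub_eq_zero.2 h1)
  rw [← Finset.sum_sub_distrib]
  refine Finset.sum_congr rfl fun j _ => ?_
  rw [hW.legDifference_eq]
  split_ifs
  · rfl
  · simp

theorem IsExchangeSystem.oneHyperArcRelations (hW : IsExchangeSystem ν W) :
    OneHyperArcRelations W := by
  classical
  intro n τ
  exact hW.sum_legDifference τ (fun x => τ.SameCycle none x)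
    fun x => Equiv.Perm.sameCycle_apply_right

theorem IsExchangeSystem.twoHyperArcRelations (hW : IsExchangeSystem ν W) :
    TwoHyperArcRelations W := by
  classical
  intro n τ i _
  exact hW.sum_legDifference τ (fun x => τ.SameCycle (some i) x)
    fun x => Equiv.Perm.sameCycle_apply_right

theorem placeFree_zero_eq {n : ℕ} (τ : Equiv.Perm (Option (Fin n))) :
    placeFree τ 0 =
      finRotate (n + 1) * placeFree τ (Fin.last n) * (finRotate (n + 1))⁻¹ := by
  have key : ∀ x, finRotate (n + 1) ((finSuccEquiv' (Fin.last n)).symm x) =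
      (finSuccEquiv' 0).symm x := by
    rintro (_ | l)
    · simp
    · simp
  rw [eq_mul_inv_iff_mul_eq]
  ext x : 1
  obtain ⟨y, rfl⟩ := (finSuccEquiv' (Fin.last n)).symm.surjective x
  rw [Equiv.Perm.mul_apply, Equiv.Perm.mul_apply, key]
  simp only [placeFree, Equiv.permCongr_apply, Equiv.symm_symm, Equiv.apply_symm_apply, key]

theorem IsExchangeSystem.rotate (hW : IsExchangeSystem ν W) {m : ℕ} (α : HyperArc m) :
    W m (finRotate m * α * (finRotate m)⁻¹) = W m α := by
  cases m with
  | zero => exact congrArg _ (Subsingleton.elim _ _)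
  | succ n =>
    obtain ⟨τ, rfl⟩ := exists_placeFree_eq α (Fin.last n)
    rw [← placeFree_zero_eq]
    -- Carried past all fixed legs, the free leg moves from the first place to the last; the
    -- differences telescope.
    have h := hW.sum_legDifference τ (fun _ => True) fun _ => Iff.rfl
    simp only [Finset.filter_true, legDifference] at h
    rw [Finset.sum_sub_distrib, sub_eq_zero] at h
    have h1 := Fin.sum_univ_succ fun p => W (n + 1) (placeFree τ p)
    rw [Fin.sum_univ_castSucc, h, add_comm] at h1
    exact (add_right_cancel h1).symm

theorem IsExchangeSystem.rotate_pow (hW : IsExchangeSystem ν W) {m : ℕ} (α : HyperArc m) (i : ℕ) :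
    W m (finRotate m ^ i * α * (finRotate m ^ i)⁻¹) = W m α := by
  induction i with
  | zero => simp
  | succ i ih =>
    rw [← ih, ← hW.rotate (finRotate m ^ i * α * (finRotate m ^ i)⁻¹), pow_succ']
    simp [mul_assoc]

theorem IsExchangeSystem.rotate_zpow (hW : IsExchangeSystem ν W) {m : ℕ} (α : HyperArc m) (i : ℤ) :
    W m (finRotate m ^ i * α * (finRotate m ^ i)⁻¹) = W m α := by
  obtain ⟨k, rfl | rfl⟩ := i.eq_nat_or_neg
  · simpa using hW.rotate_pow α k
  · rw [← hW.rotate_pow (finRotate m ^ (-(k : ℤ)) * α * (finRotate m ^ (-(k : ℤ)))⁻¹) k]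
    simp [mul_assoc]

theorem concat_swap {m n : ℕ} (α : HyperArc m) (β : HyperArc n) :
    concat β α = (finCongr (Nat.add_comm m n)).permCongr
      (finRotate (m + n) ^ n * concat α β * (finRotate (m + n) ^ n)⁻¹) := by
  have hadd : ∀ (x : Fin (m + n)), ((finRotate (m + n) ^ n) x : ℕ) = (x + n) % (m + n) := by
    intro x
    have : NeZero (m + n) := x.neZero
    have h : ∀ i : ℕ, (((finRotate (m + n)) ^ i) x : ℕ) = (x + i) % (m + n) := by
      intro i
      induction i with
      | zero => simp [Nat.mod_eq_of_lt x.2]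
      | succ i ih =>
        rw [pow_succ', Equiv.Perm.mul_apply, finRotate_apply, Fin.val_add, ih, Fin.val_one',
          ← Nat.add_mod, add_assoc]
    exact h n
  have key : ∀ y : Fin m ⊕ Fin n, finCongr (Nat.add_comm m n)
      ((finRotate (m + n) ^ n) (finSumFinEquiv y)) = finSumFinEquiv y.swap := by
    rintro (y | y) <;> ext
    · simp only [finCongr_apply, Fin.val_cast, hadd]
      simp only [finSumFinEquiv_apply_left, Fin.val_castAdd, Sum.swap_inl,
        finSumFinEquiv_apply_right, Fin.val_natAdd]
      rw [Nat.mod_eq_of_lt (by omega), add_comm]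
    · simp only [finCongr_apply, Fin.val_cast, hadd]
      simp only [finSumFinEquiv_apply_right, Fin.val_natAdd, Sum.swap_inr,
        finSumFinEquiv_apply_left, Fin.val_castAdd]
      rw [show m + (y : ℕ) + n = y + (m + n) by ring, Nat.add_mod_right,
        Nat.mod_eq_of_lt (by omega)]
  have key2 : ∀ z : Fin n ⊕ Fin m, (finCongr (Nat.add_comm m n)).symm (finSumFinEquiv z) =
      (finRotate (m + n) ^ n) (finSumFinEquiv z.swap) := by
    intro z
    rw [Equiv.symm_apply_eq, key, Sum.swap_swap]
  ext x : 1
  obtain ⟨z, rfl⟩ := finSumFinEquiv.surjective x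
  rw [Equiv.permCongr_apply, key2, Equiv.Perm.mul_apply, Equiv.Perm.mul_apply,
    Equiv.Perm.inv_def, Equiv.symm_apply_apply, concat, concat, Equiv.permCongr_apply, Equiv.permCongr_apply,
    Equiv.symm_apply_apply, Equiv.symm_apply_apply, key]
  cases z <;> simp

theorem apply_permCongr_finCongr {A : Type*} (W : ∀ m : ℕ, HyperArc m → A) {m n : ℕ} (h : m = n)
    (α : HyperArc m) : W n ((finCongr h).permCongr α) = W m α := by
  subst h
  rfl

/-- The two concatenations differ by a rotation. This allows values in a noncommutative ring to be
substituted into commutative polynomials. -/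
theorem IsExchangeSystem.mul_comm (hW : IsExchangeSystem ν W) {m n : ℕ} (α : HyperArc m)
    (β : HyperArc n) : W m α * W n β = W n β * W m α := by
  rw [← hW.concat_eq, ← hW.concat_eq, concat_swap α β, apply_permCongr_finCongr W, hW.rotate_pow]

end ExchangeSystem

/-! ### Ordered products in a noncommutative ring -/

section OrderedProduct

variable {A : Type*} [Ring A]

/-- The product `f 0 * f 1 * ⋯` of a finite sequence in a noncommutative ring. -/
def orderedProd {n : ℕ} (f : Fin n → A) : A := (List.ofFn f).prod

theorem orderedProd_succ {n : ℕ} (f : Fin (n + 1) → A) :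
    orderedProd f = f 0 * orderedProd fun l => f l.succ := by
  simp [orderedProd, List.ofFn_succ]

theorem orderedProd_append {m n : ℕ} (f : Fin (m + n) → A) :
    orderedProd f =
      orderedProd (fun l => f (Fin.castAdd n l)) * orderedProd fun l => f (Fin.natAdd m l) := by
  rw [orderedProd, orderedProd, orderedProd, List.ofFn_add, List.prod_append]
  rfl

/-- Two neighbouring factors may be merged. -/
theorem orderedProd_eq_merge {n : ℕ} (f : Fin (n + 2) → A) (k : Fin (n + 1)) :
    orderedProd f = orderedProd
      (Function.update (fun l => f (k.succ.succAbove l)) k (f k.castSucc * f k.succ)) := by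
  induction n with
  | zero =>
    obtain rfl := Fin.fin_one_eq_zero k
    simp [orderedProd]
  | succ n ih =>
    refine Fin.cases ?_ (fun k => ?_) k
    · rw [orderedProd_succ, orderedProd_succ fun l => f l.succ,
        orderedProd_succ (Function.update _ _ _), ← mul_assoc]
      rfl
    · rw [orderedProd_succ, ih (fun l => f l.succ) k,
        orderedProd_succ (Function.update _ k.succ _)]
      congr 1
      congr 1
      ext l
      rcases eq_or_ne l k with rfl | h
      · simp
      · simp [h]

theorem orderedProd_update_sub {n : ℕ} (f : Fin n → A) (k : Fin n) (a b : A) :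
    orderedProd (Function.update f k (a - b)) =
      orderedProd (Function.update f k a) - orderedProd (Function.update f k b) :=
  (MultilinearMap.mkPiAlgebraFin ℤ n A).map_update_sub f k a b

theorem orderedProd_update_zero {n : ℕ} (f : Fin n → A) (k : Fin n) :
    orderedProd (Function.update f k 0) = 0 :=
  (MultilinearMap.mkPiAlgebraFin ℤ n A).map_update_zero f k

theorem orderedProd_insertNth_sum {n : ℕ} {κ : Type*} (s : Finset κ) (f : Fin n → A)
    (p : Fin (n + 1)) (z : κ → A) :
    orderedProd (p.insertNth (α := fun _ => A) (∑ x ∈ s, z x) f) =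
      ∑ x ∈ s, orderedProd (p.insertNth (α := fun _ => A) (z x) f) := by
  have h := (MultilinearMap.mkPiAlgebraFin ℤ (n + 1) A).map_update_sum s p z
    (p.insertNth (α := fun _ => A) 0 f)
  simp only [Fin.update_insertNth] at h
  exact h

theorem orderedProd_insertNth_of_commute {n : ℕ} (f : Fin n → A) (p : Fin (n + 1)) (z : A)
    (hz : ∀ l, Commute z (f l)) :
    orderedProd (p.insertNth (α := fun _ => A) z f) = z * orderedProd f := by
  induction n with
  | zero =>
    obtain rfl := Fin.fin_one_eq_zero p
    simp [orderedProd]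
  | succ n ih =>
    refine Fin.cases ?_ (fun p => ?_) p
    · rw [orderedProd_succ]; simp
    · have h0 : p.succ.insertNth (α := fun _ => A) z f 0 = f 0 :=
        Fin.insertNth_apply_succAbove (α := fun _ => A) p.succ z f 0
      have hs : (fun l : Fin (n + 1) => p.succ.insertNth (α := fun _ => A) z f l.succ) =
          p.insertNth (α := fun _ => A) z fun l => f l.succ := by
        ext l
        refine p.succAboveCases ?_ (fun l => ?_) l
        · simp
        · rw [← Fin.succ_succAbove_succ, Fin.insertNth_apply_succAbove,
            Fin.insertNth_apply_succAbove]
      rw [orderedProd_succ, h0, hs, ih _ p fun l => hz l.succ, orderedProd_succ f, ← mul_assoc,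
        ← mul_assoc, (hz 0).eq]

theorem orderedProd_update_contract (a : Prop) [Decidable a] {n : ℕ} (f : Fin n → A) (k : Fin n)
    (x : A) : orderedProd (Function.update f k (if a then x else 0)) =
      if a then orderedProd (Function.update f k x) else 0 := by
  split_ifs
  · rfl
  · exact orderedProd_update_zero f k

end OrderedProduct

/-! ### Exchange systems from `gl` generators -/

section GlElements

variable {A : Type*} [Ring A] {ι : Type*}

/-- The commutation relations of the standard generators of the Lie algebra `gl`. -/
def IsGlGenerators [DecidableEq ι] (E : ι → ι → A) : Prop :=
  ∀ i j k l, E i j * E k l - E k l * E i j =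
    (if j = k then E i l else 0) - (if l = i then E k j else 0)

/-- The sum of the products of the generators `E` along a permutation. -/
def glValue [Fintype ι] (E : ι → ι → A) (m : ℕ) (α : HyperArc m) : A :=
  ∑ i : Fin m → ι, orderedProd fun l => E (i l) (i (α l))

variable [Fintype ι] {E : ι → ι → A}

theorem sum_fin_succ_fun {n : ℕ} (p : Fin (n + 1)) (F : (Fin (n + 1) → ι) → A) :
    ∑ i, F i = ∑ j : Fin n → ι, ∑ x, F (p.insertNth (α := fun _ => ι) x j) := by
  rw [← (Fin.insertNthEquiv (fun _ => ι) p).sum_comp, Fintype.sum_prod_type, Finset.sum_comm]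
  rfl

theorem glValue_concat (E : ι → ι → A) {m n : ℕ} (α : HyperArc m) (β : HyperArc n) :
    glValue E (m + n) (concat α β) = glValue E m α * glValue E n β := by
  rw [glValue, glValue, glValue, ← (Fin.appendEquiv m n).sum_comp, Fintype.sum_prod_type,
    Finset.sum_mul_sum]
  refine Finset.sum_congr rfl fun i _ => Finset.sum_congr rfl fun j _ => ?_
  rw [orderedProd_append]
  simp [concat, Fin.appendEquiv]

/-- If `σ` moves `p`, the condition determines the index at `p`, which amounts to erasing the leg.
If `σ` fixes `p`, that index is free and its summation gives `card ι`, the source of `ν`. -/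
theorem sum_contraction [DecidableEq ι] (E : ι → ι → A) {n : ℕ} (p : Fin (n + 1)) (σ : HyperArc (n + 1)) :
    (∑ i : Fin (n + 1) → ι, if i p = i (σ p) then
        orderedProd fun l : Fin n => E (i (p.succAbove l)) (i (σ (p.succAbove l))) else 0) =
      contraction (Fintype.card ι : A) (glValue E) p σ := by
  rw [sum_fin_succ_fun p, contraction, glValue, Finset.mul_sum]
  refine Finset.sum_congr rfl fun j _ => ?_
  by_cases h : σ p = p
  · have h1 : ∀ l, σ (p.succAbove l) = p.succAbove (eraseLeg p σ l) := fun l => by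
      rw [succAbove_eraseLeg, if_neg]
      exact fun h2 => Fin.succAbove_ne p l (σ.injective (h2.trans h.symm))
    simp [h, h1]
  · obtain ⟨q, hq⟩ := Fin.exists_succAbove_eq h
    rw [if_neg h, one_mul]
    simp only [← hq, Fin.insertNth_apply_same,
      Fin.insertNth_apply_succAbove, Finset.sum_ite_eq', Finset.mem_univ, if_true]
    refine congrArg orderedProd (funext fun l => congrArg _ ?_)
    by_cases h2 : σ (p.succAbove l) = p
    · have h3 := succAbove_eraseLeg p σ l
      rw [if_pos h2, ← hq] at h3
      rw [h2, Fin.insertNth_apply_same, Fin.succAbove_right_injective h3]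
    · have h3 := succAbove_eraseLeg p σ l
      rw [if_neg h2] at h3
      rw [← h3, Fin.insertNth_apply_succAbove]

theorem glValue_one (E : ι → ι → A) : glValue E 1 1 = ∑ x, E x x := by
  rw [glValue, ← (Equiv.funUnique (Fin 1) ι).symm.sum_comp]
  simp [orderedProd]

variable [DecidableEq ι]

theorem adjSwap_succAbove_of_ne {n : ℕ} {k l : Fin (n + 1)} (h : l ≠ k) :
    k.succ.succAbove l = k.castSucc.succAbove l := by
  rw [← adjSwap_castSucc_succAbove, adjSwap, Equiv.swap_apply_of_ne_of_ne]
  · exact Fin.succAbove_ne _ _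
  · intro h2
    rw [← Fin.succAbove_castSucc_self] at h2
    exact h (Fin.succAbove_right_injective h2)

theorem glValue_exchange (hE : IsGlGenerators E) {n : ℕ} (α : HyperArc (n + 2))
    (k : Fin (n + 1)) :
    glValue E (n + 2) α - glValue E (n + 2) (adjSwap k * α * adjSwap k) =
      contraction (Fintype.card ι : A) (glValue E) k.succ (α * adjSwap k) -
        contraction (Fintype.card ι : A) (glValue E) k.castSucc (α * adjSwap k) := by
  have hl : adjSwap k k.castSucc = k.succ := Equiv.swap_apply_left _ _
  have hr : adjSwap k k.succ = k.castSucc := Equiv.swap_apply_right _ _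
  have h1 : glValue E (n + 2) (adjSwap k * α * adjSwap k) =
      ∑ i : Fin (n + 2) → ι, orderedProd fun l => E (i (adjSwap k l)) (i (α (adjSwap k l))) := by
    -- Reindexed by the exchange, the second sum differs from the first only in the order of two
    -- neighbouring factors.
    rw [glValue, ← ((adjSwap k).arrowCongr (Equiv.refl ι)).sum_comp]
    refine Finset.sum_congr rfl fun i _ => ?_
    have h2 : (adjSwap k).symm = adjSwap k := Equiv.symm_swap _ _
    have h3 : ∀ x, adjSwap k (adjSwap k x) = x := fun x => by
      rw [← Equiv.Perm.mul_apply, adjSwap_mul_self, Equiv.Perm.one_apply]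
    simp [Equiv.arrowCongr, h2, h3]
  rw [h1, ← sum_contraction, ← sum_contraction, glValue, ← Finset.sum_sub_distrib,
    ← Finset.sum_sub_distrib]
  refine Finset.sum_congr rfl fun i _ => ?_
  set σ := α * adjSwap k with hσ
  have hα : ∀ l, α l = σ (adjSwap k l) := fun l => by
    rw [hσ, Equiv.Perm.mul_apply, ← Equiv.Perm.mul_apply (adjSwap k), adjSwap_mul_self]; rfl
  have h3 : ∀ l, α (adjSwap k l) = σ l := fun l => rfl
  rw [orderedProd_eq_merge _ k, orderedProd_eq_merge (fun l => E (i (adjSwap k l)) _) k]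
  simp only [h3, hl, hr, hα]
  have h4 : ∀ x, Function.update
      (fun l => E (i (adjSwap k (k.succ.succAbove l))) (i (σ (k.succ.succAbove l)))) k x =
      Function.update
      (fun l => E (i (k.succ.succAbove l)) (i (σ (adjSwap k (k.succ.succAbove l))))) k x := by
    intro x
    ext l
    rcases eq_or_ne l k with rfl | h
    · simp
    · rw [Function.update_of_ne h, Function.update_of_ne h, adjSwap_succ_succAbove,
        adjSwap_succAbove_of_ne h]
  rw [h4, ← orderedProd_update_sub, hE, orderedProd_update_sub, orderedProd_update_contract,
    orderedProd_update_contract]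
  have h5 : Function.update
      (fun l => E (i (k.succ.succAbove l)) (i (σ (adjSwap k (k.succ.succAbove l))))) k
        (E (i k.castSucc) (i (σ k.castSucc))) =
      fun l => E (i (k.succ.succAbove l)) (i (σ (k.succ.succAbove l))) := by
    ext l
    rcases eq_or_ne l k with rfl | h
    · simp
    · rw [Function.update_of_ne h, adjSwap_succ_succAbove, adjSwap_succAbove_of_ne h]
  have h6 : Function.update
      (fun l => E (i (k.succ.succAbove l)) (i (σ (adjSwap k (k.succ.succAbove l))))) k
        (E (i k.succ) (i (σ k.succ))) =
      fun l => E (i (k.castSucc.succAbove l)) (i (σ (k.castSucc.succAbove l))) := by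
    ext l
    rcases eq_or_ne l k with rfl | h
    · simp
    · rw [Function.update_of_ne h, adjSwap_succ_succAbove, adjSwap_succAbove_of_ne h]
  rw [h5, h6]
  simp only [eq_comm]

theorem commute_sum_diag (hE : IsGlGenerators E) (i j : ι) :
    Commute (∑ x, E x x) (E i j) := by
  rw [Commute, SemiconjBy, ← sub_eq_zero, Finset.sum_mul, Finset.mul_sum,
    ← Finset.sum_sub_distrib]
  simp [hE _ _ _ _]

/-- The factor at a fixed leg sums to the trace `∑ x, E x x`, which commutes with all generators and
moves to the front. -/
theorem glValue_fixed_leg (hE : IsGlGenerators E) {n : ℕ} (α : HyperArc (n + 1))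
    (p : Fin (n + 1)) (h : α p = p) :
    glValue E (n + 1) α = glValue E 1 1 * glValue E n (eraseLeg p α) := by
  have h1 : ∀ l, α (p.succAbove l) = p.succAbove (eraseLeg p α l) := fun l => by
    rw [succAbove_eraseLeg, if_neg]
    exact fun h2 => Fin.succAbove_ne p l (α.injective (h2.trans h.symm))
  rw [glValue_one, glValue, sum_fin_succ_fun p, glValue, Finset.mul_sum]
  refine Finset.sum_congr rfl fun j _ => ?_
  rw [← orderedProd_insertNth_of_commute _ p _ fun l => commute_sum_diag hE _ _,
    orderedProd_insertNth_sum]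
  refine Finset.sum_congr rfl fun x _ => ?_
  congr 1
  ext l
  refine p.succAboveCases ?_ (fun l => ?_) l
  · simp [h]
  · simp [h1]

theorem isExchangeSystem_glValue (hE : IsGlGenerators E) :
    IsExchangeSystem (Fintype.card ι : A) (glValue E) where
  empty_eq := by simp [glValue, orderedProd]
  concat_eq _ _ := glValue_concat E
  exchange _ := glValue_exchange hE
  fixed_leg _ := glValue_fixed_leg hE

end GlElements

/-! ### Reduction of diagrams to standard cycles -/

theorem exists_conj_finRotate {n : ℕ} (α : HyperArc (n + 2)) (h : ∀ x, α.SameCycle 0 x) :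
    ∃ g, g * finRotate (n + 2) * g⁻¹ = α := by
  rw [← isConj_iff, Equiv.Perm.isConj_iff_cycleType_eq, cycleType_finRotate]
  have h0 : α 0 ≠ 0 := fun h0 => by
    obtain ⟨i, hi⟩ := h 1
    rw [Equiv.Perm.zpow_apply_eq_self_of_apply_eq_self h0] at hi
    exact absurd hi (by simp)
  have h1 : ∀ x, α x ≠ x := fun x => ((h x).apply_eq_self_iff.not).1 h0
  have h2 : α.IsCycle := ⟨0, h0, fun y _ => h y⟩
  have h3 : α.support = Finset.univ := by ext x; simp [h1]
  rw [h2.cycleType, h3, Finset.card_univ, Fintype.card_fin]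

/-- Relabel so that the legs of the cycle through `x` come first and all others after them. -/
theorem exists_conj_concat {m : ℕ} (α : HyperArc m) (x y : Fin m) (h : ¬ α.SameCycle x y) :
    ∃ (a b : ℕ) (hab : a + b = m) (β : HyperArc a) (γ : HyperArc b) (g : HyperArc m),
      a < m ∧ b < m ∧ g * (finCongr hab).permCongr (concat β γ) * g⁻¹ = α := by
  classical
  let p : Fin m → Prop := fun z => α.SameCycle x z
  have hp : ∀ z, p (α z) ↔ p z := fun z => Equiv.Perm.sameCycle_apply_right
  let e₁ : {z // p z} ≃ Fin (Fintype.card {z // p z}) := Fintype.equivFin _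
  let e₂ : {z // ¬ p z} ≃ Fin (Fintype.card {z // ¬ p z}) := Fintype.equivFin _
  have hab : Fintype.card {z // p z} + Fintype.card {z // ¬ p z} = m := by
    rw [← Fintype.card_sum, Fintype.card_congr (Equiv.sumCompl p), Fintype.card_fin]
  have ha : 0 < Fintype.card {z // p z} :=
    Fintype.card_pos_iff.2 ⟨⟨x, Equiv.Perm.SameCycle.refl _ _⟩⟩
  have hb : 0 < Fintype.card {z // ¬ p z} := Fintype.card_pos_iff.2 ⟨⟨y, h⟩⟩
  let e : Fin m ≃ Fin m := (Equiv.sumCompl p).symm.trans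
    ((e₁.sumCongr e₂).trans (finSumFinEquiv.trans (finCongr hab)))
  refine ⟨_, _, hab, e₁.permCongr (α.subtypePerm hp),
    e₂.permCongr (α.subtypePerm fun z => not_congr (hp z)), e⁻¹, by omega, by omega, ?_⟩
  rw [inv_inv, mul_assoc, inv_mul_eq_iff_eq_mul]
  ext z : 1
  by_cases hz : p z
  · have h1 : p (α z) := (hp z).2 hz
    simp [e, concat, Equiv.sumCompl_symm_apply_of_pos, hz, h1]
  · have h1 : ¬ p (α z) := fun h => hz ((hp z).1 h)
    simp [e, concat, Equiv.sumCompl_symm_apply_of_neg, hz, h1]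

/-- A property that is compatible with concatenation and with exchanges of neighbouring legs, and
that holds for the standard cycles, holds for all hyper arc diagrams. -/
theorem hyperArc_induction {P : ∀ m : ℕ, HyperArc m → Prop} (empty : P 0 1)
    (cycle : ∀ n : ℕ, P (n + 1) (finRotate (n + 1)))
    (concat : ∀ (m n : ℕ) (α : HyperArc m) (β : HyperArc n), P m α → P n β →
      P (m + n) (concat α β))
    (exchange : ∀ (n : ℕ) (α : HyperArc (n + 2)) (k : Fin (n + 1)),
      (∀ m < n + 2, ∀ β : HyperArc m, P m β) → P (n + 2) α →
        P (n + 2) (adjSwap k * α * adjSwap k)) (m : ℕ) (α : HyperArc m) : P m α := by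
  induction m using Nat.strong_induction_on with
  | _ m ih =>
    match m, α, ih with
    | 0, α, _ => rwa [Subsingleton.elim α 1]
    | 1, α, _ => rw [Subsingleton.elim α (finRotate 1)]; exact cycle 0
    | n + 2, α, ih =>
      -- Neighbouring transpositions generate the symmetric group, so single exchanges suffice for
      -- every conjugation.
      have conj : ∀ (g β : HyperArc (n + 2)), P (n + 2) β → P (n + 2) (g * β * g⁻¹) := by
        intro g
        have hg : g ∈ Submonoid.closure
            (Set.range fun i : Fin (n + 1) => Equiv.swap i.castSucc i.succ) := by
          rw [Equiv.Perm.mclosure_swap_castSucc_succ]; trivial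
        induction hg using Submonoid.closure_induction with
        | mem g hg =>
          obtain ⟨k, rfl⟩ := hg
          intro β hβ
          have := exchange n β k ih hβ
          rwa [adjSwap] at this
        | one => intro β hβ; simpa using hβ
        | mul g g' _ _ h h' =>
          intro β hβ
          have := h _ (h' β hβ)
          rwa [mul_inv_rev, mul_assoc, mul_assoc, ← mul_assoc g' β, ← mul_assoc (g' * β),
            ← mul_assoc g]
      by_cases h : ∀ x, α.SameCycle 0 x
      · obtain ⟨g, rfl⟩ := exists_conj_finRotate α h
        exact conj g _ (cycle (n + 1))
      · push Not at h
        obtain ⟨y, hy⟩ := h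
        obtain ⟨a, b, hab, β, γ, g, ha, hb, rfl⟩ := exists_conj_concat α 0 y hy
        apply conj
        rw [apply_permCongr_finCongr P hab]
        exact concat a b β γ (ih a ha β) (ih b hb γ)

/-! ### Numbers with prescribed power sums -/

section PowerSums

open Finset

/-- The elementary symmetric functions, computed from the power sums `c` by Newton's identities. -/
noncomputable def newtonEsymm (c : ℕ → ℂ) : ℕ → ℂ
  | 0 => 1
  | k + 1 => (-1) ^ k / (k + 1) *
      (c (k + 1) + ∑ i : Fin k, (-1) ^ ((i : ℕ) + 1) * newtonEsymm c (i + 1) * c (k - i))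

theorem exists_multiset_map_eq {X : Type*} (s : Multiset X) (N : ℕ) (h : Multiset.card s = N) :
    ∃ f : Fin N → X, (Finset.univ.val.map f) = s := by
  subst h
  induction s using Quotient.inductionOn with
  | _ l => exact ⟨l.get, congrArg _ (List.map_get_finRange l)⟩

/-- The numbers are the roots of the monic polynomial whose coefficients are the signed values `e
k`, by Vieta. -/
theorem exists_esymm_eq (e : ℕ → ℂ) (he : e 0 = 1) (N : ℕ) :
    ∃ x : Fin N → ℂ, ∀ k ≤ N, MvPolynomial.aeval x (MvPolynomial.esymm (Fin N) ℂ k) = e k := by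
  let q : Polynomial ℂ := ∑ k ∈ range N, Polynomial.monomial k ((-1) ^ (N - k) * e (N - k))
  let p : Polynomial ℂ := Polynomial.X ^ N + q
  have hq : q.degree < N := by
    refine (Polynomial.degree_sum_le _ _).trans_lt ((Finset.sup_lt_iff (WithBot.bot_lt_coe N)).2 ?_)
    intro k hk
    exact (Polynomial.degree_monomial_le _ _).trans_lt (Nat.cast_lt.2 (mem_range.1 hk))
  have hp : p.natDegree = N := by
    rw [Polynomial.natDegree_add_eq_left_of_degree_lt (by rwa [Polynomial.degree_X_pow]),
      Polynomial.natDegree_X_pow]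
  have hm : p.Monic := Polynomial.monic_X_pow_add hq
  have hr : Multiset.card p.roots = p.natDegree :=
    Polynomial.splits_iff_card_roots.1 (IsAlgClosed.splits p)
  obtain ⟨x, hx⟩ := exists_multiset_map_eq p.roots N (hr.trans hp)
  refine ⟨x, fun k hk => ?_⟩
  have hc := Polynomial.coeff_eq_esymm_roots_of_card hr (k := N - k) (by omega)
  rw [hm.leadingCoeff, one_mul, hp, Nat.sub_sub_self hk] at hc
  rw [MvPolynomial.aeval_esymm_eq_multiset_esymm, hx]
  have hcoeff : p.coeff (N - k) = (-1) ^ k * e k := by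
    rcases Nat.eq_zero_or_pos k with rfl | hk0
    · rw [Nat.sub_zero, Polynomial.coeff_add, Polynomial.coeff_eq_zero_of_degree_lt hq]
      simp [he]
    · have h1 : N - k < N := by omega
      simp [p, q, Polynomial.coeff_monomial, Polynomial.coeff_X_pow, h1.ne, h1,
        Nat.sub_sub_self hk]
  rw [hcoeff] at hc
  exact (mul_left_cancel₀ (pow_ne_zero _ (by norm_num)) hc).symm

/-- The first `N` power sums of `N` complex numbers can be prescribed. -/
theorem exists_powerSum_eq (c : ℕ → ℂ) (N : ℕ) :
    ∃ x : Fin N → ℂ, ∀ m, 1 ≤ m → m ≤ N → ∑ i, x i ^ m = c m := by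
  obtain ⟨x, hx⟩ := exists_esymm_eq (newtonEsymm c) (by rw [newtonEsymm]) N
  refine ⟨x, fun m => ?_⟩
  induction m using Nat.strong_induction_on with
  | _ m ih =>
    intro h1 h2
    obtain ⟨k, rfl⟩ : ∃ k, m = k + 1 := ⟨m - 1, by omega⟩
    have h := congrArg (MvPolynomial.aeval x)
      (MvPolynomial.psum_eq_mul_esymm_sub_sum (Fin N) ℂ (k + 1) (by omega))
    have hps : ∀ m, MvPolynomial.aeval x (MvPolynomial.psum (Fin N) ℂ m) = ∑ i, x i ^ m :=
      fun m => by simp [MvPolynomial.psum]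
    -- The terms of Newton's identity only involve power sums of lower degree, known by induction.
    have hsum : ∑ a ∈ antidiagonal (k + 1) with a.1 ∈ Set.Ioo 0 (k + 1),
        (-1) ^ a.1 * MvPolynomial.aeval x (MvPolynomial.esymm (Fin N) ℂ a.1) *
          MvPolynomial.aeval x (MvPolynomial.psum (Fin N) ℂ a.2) =
        ∑ i : Fin k, (-1) ^ ((i : ℕ) + 1) * newtonEsymm c (i + 1) * c (k - i) := by
      rw [sum_filter, Finset.Nat.sum_antidiagonal_eq_sum_range_succ_mk, sum_range_succ,
        sum_range_succ', Fin.sum_univ_eq_sum_range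
          (fun i => (-1) ^ (i + 1) * newtonEsymm c (i + 1) * c (k - i))]
      simp only [Set.mem_Ioo, lt_irrefl, false_and, and_false, if_false, add_zero]
      refine sum_congr rfl fun i hi => ?_
      have hi' := mem_range.1 hi
      rw [if_pos ⟨by omega, by omega⟩, hx _ (by omega), hps, Nat.add_sub_add_right,
        ih _ (by omega) (by omega) (by omega)]
    rw [hps] at h
    simp only [map_sub, map_mul, map_sum, map_pow, map_neg, map_one, map_natCast] at h
    rw [hsum, hx _ h2, newtonEsymm] at h
    rw [h]
    have hk : (k : ℂ) + 1 ≠ 0 := by exact_mod_cast Nat.succ_ne_zero k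
    have hsq : ((-1 : ℂ) ^ k) * (-1) ^ k = 1 := by rw [← mul_pow]; simp
    push_cast
    rw [pow_add, pow_add]
    field_simp
    linear_combination (c (k + 1) + ∑ i : Fin k, (-1) ^ ((i : ℕ) + 1) * newtonEsymm c (i + 1) *
      c (k - i)) * hsq

end PowerSums

/-! ### A representation of `gl` with a formal parameter -/

section DifferentialOperators

variable (ι : Type*) [DecidableEq ι]

/-- Polynomial functions on square matrices. -/
abbrev MatrixPoly : Type _ := MvPolynomial (ι × ι) ℂ

variable {ι}

/-- The vector field on the space of square matrices given by left multiplication by a matrix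
unit. -/
noncomputable def leftField (k l : ι) : Derivation ℂ (MatrixPoly ι) (MatrixPoly ι) :=
  MvPolynomial.mkDerivation ℂ fun ij => if l = ij.1 then MvPolynomial.X (k, ij.2) else 0

theorem leftField_X (k l i j : ι) : leftField k l (MvPolynomial.X (i, j)) =
    if l = i then MvPolynomial.X (k, j) else 0 := by
  simp [leftField, MvPolynomial.mkDerivation_X]

theorem leftField_lie (i j k l : ι) : ⁅leftField i j, leftField k l⁆ =
    (if j = k then leftField i l else 0) - if l = i then leftField k j else 0 := by
  apply MvPolynomial.derivation_ext
  rintro ⟨a, b⟩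
  simp only [Derivation.commutator_apply, leftField_X]
  split_ifs <;> simp_all [leftField_X]

/-- The differential operator `f ↦ t y_ij f + D_ij f`, where `t` is a formal parameter. -/
noncomputable def glOperator (i j : ι) : Polynomial (Module.End ℂ (MatrixPoly ι)) :=
  Polynomial.C (Algebra.lmul ℂ (MatrixPoly ι) (MvPolynomial.X (i, j))) * Polynomial.X +
    Polynomial.C (leftField i j : MatrixPoly ι →ₗ[ℂ] MatrixPoly ι)

theorem linear_mul_linear {A : Type*} [Ring A] (a b c d : A) :
    (Polynomial.C a * Polynomial.X + Polynomial.C b) *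
      (Polynomial.C c * Polynomial.X + Polynomial.C d) =
    Polynomial.C (a * c) * Polynomial.X ^ 2 + Polynomial.C (a * d + b * c) * Polynomial.X +
      Polynomial.C (b * d) := by
  simp only [mul_add, add_mul, map_mul, map_add, pow_two, mul_assoc, Polynomial.X_mul_C]
  rw [← mul_assoc Polynomial.X (Polynomial.C c), Polynomial.X_mul_C, mul_assoc]
  abel

theorem quadratic_sub_quadratic {A : Type*} [Ring A] (p : Polynomial A) (a b c d u v : A) :
    (p + Polynomial.C (a + (b + c)) * Polynomial.X + Polynomial.C u) -
      (p + Polynomial.C (b + (a + d)) * Polynomial.X + Polynomial.C v) =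
    Polynomial.C (c - d) * Polynomial.X + Polynomial.C (u - v) := by
  simp only [map_add, map_sub, add_mul, sub_mul]
  abel

theorem derivation_mul_lmul {R : Type*} [CommRing R] [Algebra ℂ R] (D : Derivation ℂ R R) (y : R) :
    (D : R →ₗ[ℂ] R) * Algebra.lmul ℂ R y =
      Algebra.lmul ℂ R y * (D : R →ₗ[ℂ] R) + Algebra.lmul ℂ R (D y) := by
  ext f
  simp [mul_comm]

/-- In the commutator the `t²` terms cancel, as multiplications commute. The `t` term is
multiplication by `D_ij y_kl - D_kl y_ij`, and the constant term is the bracket of vector fields;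
both have the `gl` structure constants. -/
theorem isGlGenerators_glOperator : IsGlGenerators (glOperator (ι := ι)) := by
  intro i j k l
  have h1 := derivation_mul_lmul (leftField i j) (MvPolynomial.X (k, l))
  have h2 := derivation_mul_lmul (leftField k l) (MvPolynomial.X (i, j))
  have h3 : (leftField i j : MatrixPoly ι →ₗ[ℂ] MatrixPoly ι) * leftField k l -
      (leftField k l : MatrixPoly ι →ₗ[ℂ] MatrixPoly ι) * leftField i j =
      (if j = k then (leftField i l : MatrixPoly ι →ₗ[ℂ] MatrixPoly ι) else 0) -
        if l = i then (leftField k j : MatrixPoly ι →ₗ[ℂ] MatrixPoly ι) else 0 := by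
    rw [← Ring.lie_def, ← Derivation.commutator_coe_linear_map, leftField_lie]
    split_ifs <;> rfl
  rw [leftField_X] at h1 h2
  rw [glOperator, glOperator, linear_mul_linear, linear_mul_linear, h1, h2, ← map_mul, ← map_mul,
    mul_comm (MvPolynomial.X (k, l)), quadratic_sub_quadratic, h3]
  split_ifs <;> simp [glOperator, sub_mul] <;> abel

end DifferentialOperators

/-! ### Top coefficients in the parameter -/

section Symbol

variable {ι : Type*}

/-- The operator `f` has degree at most `d` in the formal parameter, and its coefficient of degree
`d` is the multiplication by `r`. -/
def HasSymbol (f : Polynomial (Module.End ℂ (MatrixPoly ι))) (d : ℕ) (r : MatrixPoly ι) : Prop :=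
  f.natDegree ≤ d ∧ f.coeff d = Algebra.lmul ℂ (MatrixPoly ι) r

theorem HasSymbol.mul {f g : Polynomial (Module.End ℂ (MatrixPoly ι))} {d e : ℕ}
    {r s : MatrixPoly ι} (hf : HasSymbol f d r) (hg : HasSymbol g e s) :
    HasSymbol (f * g) (d + e) (r * s) :=
  ⟨Polynomial.natDegree_mul_le_of_le hf.1 hg.1, by
    rw [Polynomial.coeff_mul_add_eq_of_natDegree_le hf.1 hg.1, hf.2, hg.2, map_mul]⟩

theorem HasSymbol.one : HasSymbol (1 : Polynomial (Module.End ℂ (MatrixPoly ι))) 0 1 :=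
  ⟨by simp, by rw [Polynomial.coeff_one_zero, map_one]⟩

theorem HasSymbol.pow {f : Polynomial (Module.End ℂ (MatrixPoly ι))} {d : ℕ}
    {r : MatrixPoly ι} (hf : HasSymbol f d r) (n : ℕ) : HasSymbol (f ^ n) (n * d) (r ^ n) := by
  induction n with
  | zero => simpa using HasSymbol.one
  | succ n ih => rw [pow_succ, pow_succ, Nat.succ_mul]; exact ih.mul hf

theorem HasSymbol.sum {κ : Type*} (s : Finset κ)
    {f : κ → Polynomial (Module.End ℂ (MatrixPoly ι))} {d : ℕ} {r : κ → MatrixPoly ι}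
    (hf : ∀ x ∈ s, HasSymbol (f x) d (r x)) :
    HasSymbol (∑ x ∈ s, f x) d (∑ x ∈ s, r x) :=
  ⟨Polynomial.natDegree_sum_le_of_forall_le _ _ fun x hx => (hf x hx).1, by
    rw [Polynomial.finsetSum_coeff, map_sum]
    exact Finset.sum_congr rfl fun x hx => (hf x hx).2⟩

theorem HasSymbol.natCast (n : ℕ) :
    HasSymbol (n : Polynomial (Module.End ℂ (MatrixPoly ι))) 0 n :=
  ⟨by simp, by rw [Polynomial.coeff_natCast_ite, if_pos rfl, map_natCast]⟩

theorem HasSymbol.orderedProd {n : ℕ} {f : Fin n → Polynomial (Module.End ℂ (MatrixPoly ι))}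
    {r : Fin n → MatrixPoly ι} (hf : ∀ l, HasSymbol (f l) 1 (r l)) :
    HasSymbol (orderedProd f) n (∏ l, r l) := by
  induction n with
  | zero => simpa [HyperDiagram.orderedProd] using HasSymbol.one
  | succ n ih =>
    rw [orderedProd_succ, Fin.prod_univ_succ]
    have h := (hf 0).mul (ih fun l => hf l.succ)
    rwa [Nat.add_comm 1 n] at h

variable [DecidableEq ι]

theorem hasSymbol_glOperator (i j : ι) : HasSymbol (glOperator i j) 1 (MvPolynomial.X (i, j)) :=
  ⟨Polynomial.natDegree_linear_le, by simp [glOperator]⟩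

variable [Fintype ι]

/-- The symbol of the standard cycle: the trace of a power of the generic matrix. -/
noncomputable def tracePower (ι : Type*) [Fintype ι] (m : ℕ) : MatrixPoly ι :=
  ∑ i : Fin m → ι, ∏ l, MvPolynomial.X (i l, i (finRotate m l))

theorem hasSymbol_glValue (m : ℕ) :
    HasSymbol (glValue (glOperator (ι := ι)) m (finRotate m)) m (tracePower ι m) :=
  HasSymbol.sum _ fun _ _ => HasSymbol.orderedProd fun _ => hasSymbol_glOperator _ _

/-- At a diagonal matrix only constant index sequences contribute. -/
theorem aeval_tracePower (x : ι → ℂ) (n : ℕ) :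
    MvPolynomial.aeval (fun ij : ι × ι => if ij.1 = ij.2 then x ij.1 else 0)
      (tracePower ι (n + 1)) = ∑ i, x i ^ (n + 1) := by
  rw [tracePower, map_sum]
  symm
  refine Fintype.sum_of_injective (fun a (_ : Fin (n + 1)) => a)
    (fun a b h => congrFun h 0) _ _ (fun i hi => ?_) fun a => by simp
  have : ∃ l, i l ≠ i (finRotate (n + 1) l) := by
    by_contra! h
    refine hi ⟨i 0, funext fun l => ?_⟩
    induction l using Fin.induction with
    | zero => rfl
    | succ l ih => rw [ih, h]; simp
  obtain ⟨l, hl⟩ := this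
  rw [map_prod]
  exact Finset.prod_eq_zero (Finset.mem_univ l) (by rw [MvPolynomial.aeval_X, if_neg hl])

end Symbol

/-! ### Evaluation of polynomials and its injectivity -/

section Evaluation

open scoped IsMulCommutative in
/-- The values of an exchange system define an evaluation of polynomials in `N, C₁, C₂, …`. -/
theorem IsExchangeSystem.exists_algHom {A : Type*} [Ring A] [Algebra ℂ A] {ν : A}
    {W : ∀ m : ℕ, HyperArc m → A} (hW : IsExchangeSystem ν W)
    (hν : ∀ m (α : HyperArc m), Commute ν (W m α)) :
    ∃ Φ : GlPoly →ₐ[ℂ] A, Φ (MvPolynomial.X GlVar.N) = ν ∧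
      ∀ m : ℕ+, Φ (MvPolynomial.X (GlVar.C m)) = W m (finRotate m) := by
  let s : Set A := insert ν (Set.range fun a : Σ m, HyperArc m => W a.1 a.2)
  have hs : ∀ a ∈ s, ∀ b ∈ s, a * b = b * a := by
    rintro a (rfl | ⟨⟨m, α⟩, rfl⟩) b (rfl | ⟨⟨n, β⟩, rfl⟩)
    · rfl
    · exact hν n β
    · exact (hν m α).symm
    · exact hW.mul_comm α β
  have : IsMulCommutative (Algebra.adjoin ℂ s) := Algebra.isMulCommutative_adjoin ℂ hs
  let g : GlVar → Algebra.adjoin ℂ s := fun v => match v with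
    | GlVar.N => ⟨ν, Algebra.subset_adjoin (Set.mem_insert _ _)⟩
    | GlVar.C m => ⟨W m (finRotate m),
        Algebra.subset_adjoin (Set.mem_insert_of_mem _ ⟨⟨m, finRotate m⟩, rfl⟩)⟩
  refine ⟨(Algebra.adjoin ℂ s).val.comp (MvPolynomial.aeval g), ?_, fun m => ?_⟩
  · rw [AlgHom.comp_apply, MvPolynomial.aeval_X]; rfl
  · rw [AlgHom.comp_apply, MvPolynomial.aeval_X]; rfl

/-- The value of `W` on every diagram is a polynomial in `ν` and the values on standard cycles. -/
theorem IsExchangeSystem.mem_range {A : Type*} [Ring A] [Algebra ℂ A] {ν : A}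
    {W : ∀ m : ℕ, HyperArc m → A} (hW : IsExchangeSystem ν W) (S : Subalgebra ℂ A) (hν : ν ∈ S)
    (hcycle : ∀ n, W (n + 1) (finRotate (n + 1)) ∈ S) (m : ℕ) (α : HyperArc m) : W m α ∈ S := by
  refine hyperArc_induction (P := fun m α => W m α ∈ S) ?_ hcycle ?_ ?_ m α
  · rw [hW.empty_eq]; exact S.one_mem
  · intro m n α β hα hβ
    rw [hW.concat_eq]
    exact S.mul_mem hα hβ
  · intro n α k ih hα
    have hc : ∀ p (σ : HyperArc (n + 2)), contraction ν W p σ ∈ S := by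
      intro p σ
      unfold contraction
      refine S.mul_mem ?_ (ih _ (Nat.lt_succ_self _) _)
      split_ifs
      exacts [hν, S.one_mem]
    have h := hW.exchange n α k
    rw [sub_eq_iff_eq_add, ← sub_eq_iff_eq_add'] at h
    rw [← h]
    exact S.sub_mem hα (S.sub_mem (hc _ _) (hc _ _))

/-- The algebra of differential operators on `N × N` matrices with a formal parameter. -/
abbrev GlAlgebra (N : ℕ) : Type := Polynomial (Module.End ℂ (MatrixPoly (Fin N)))

/-- The `gl`-weight systems for all sizes of matrices together. -/
noncomputable def glFamily (m : ℕ) (α : HyperArc m) : ∀ N, GlAlgebra N :=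
  fun _ => glValue glOperator m α

theorem isExchangeSystem_glFamily :
    IsExchangeSystem (fun N => (N : GlAlgebra N)) glFamily := by
  have h : ∀ N, IsExchangeSystem (N : GlAlgebra N) (glValue (glOperator (ι := Fin N))) :=
    fun N => by simpa using isExchangeSystem_glValue (isGlGenerators_glOperator (ι := Fin N))
  have hc : ∀ (n : ℕ) (p : Fin (n + 1)) (σ : HyperArc (n + 1)) (N : ℕ),
      contraction (fun N => (N : GlAlgebra N)) glFamily p σ N =
        contraction (N : GlAlgebra N) (glValue (glOperator (ι := Fin N))) p σ := by
    intro n p σ N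
    unfold contraction
    split_ifs <;> rfl
  exact
    { empty_eq := funext fun N => (h N).empty_eq
      concat_eq := fun m n α β => funext fun N => (h N).concat_eq m n α β
      exchange := fun n α k => funext fun N => by
        rw [Pi.sub_apply, Pi.sub_apply, hc, hc]
        exact (h N).exchange n α k
      fixed_leg := fun n α p hp => funext fun N => (h N).fixed_leg n α p hp }

/-- The degrees of the variables: `N` has degree `0` and `C_m` has degree `m`. -/
def glWeight : GlVar → ℕ
  | GlVar.N => 0
  | GlVar.C m => m

/-- The symbols of the variables. -/
noncomputable def glSymbol (N : ℕ) : GlPoly →ₐ[ℂ] MatrixPoly (Fin N) :=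
  MvPolynomial.aeval fun v => match v with
    | GlVar.N => (N : MatrixPoly (Fin N))
    | GlVar.C m => tracePower (Fin N) m

/-- The symbols of polynomials in `N, C₁, C₂, …` separate points. -/
theorem eq_zero_of_glSymbol_eq_zero (Q : GlPoly) (h : ∀ N, glSymbol N Q = 0) : Q = 0 := by
  classical
  -- Matrices of size at least `M` allow all `C_m` in `Q` to be prescribed independently.
  -- Restricting `N` to integers `≥ M` still leaves an infinite set, enough to detect a nonzero
  -- polynomial.
  obtain ⟨M, hM⟩ : ∃ M, ∀ m : ℕ+, GlVar.C m ∈ Q.vars → (m : ℕ) ≤ M := by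
    refine ⟨Q.vars.sup glWeight, fun m hm => ?_⟩
    exact Finset.le_sup (f := glWeight) hm
  let s : GlVar → Set ℂ := fun v => match v with
    | GlVar.N => (fun k : ℕ => (k : ℂ)) '' Set.Ici M
    | GlVar.C _ => Set.univ
  have hs : ∀ v, (s v).Infinite := by
    rintro (_ | _)
    · exact (Set.Ici_infinite M).image Nat.cast_injective.injOn
    · exact Set.infinite_univ
  refine MvPolynomial.funext_set s hs fun x hx => ?_
  obtain ⟨k, hk, hkx⟩ := hx GlVar.N trivial
  obtain ⟨y, hy⟩ := exists_powerSum_eq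
    (fun m => if hm : 0 < m then x (GlVar.C ⟨m, hm⟩) else 0) k
  let e : MatrixPoly (Fin k) →ₐ[ℂ] ℂ :=
    MvPolynomial.aeval fun ij : Fin k × Fin k => if ij.1 = ij.2 then y ij.1 else 0
  have h1 : (e.comp (glSymbol k) : GlPoly →+* ℂ) Q = MvPolynomial.eval x Q := by
    refine MvPolynomial.hom_congr_vars (by ext; simp) ?_ rfl
    rintro (_ | m) hv _
    · simpa [glSymbol] using hkx
    · have hm : ((m : ℕ) - 1) + 1 = m := Nat.sub_add_cancel m.2
      have h2 : e (tracePower (Fin k) m) = ∑ i, y i ^ (m : ℕ) := by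
        rw [← hm]; exact aeval_tracePower y _
      have h3 := hy m m.2 ((hM m hv).trans hk)
      have h4 : e (tracePower (Fin k) m) = x (GlVar.C m) :=
        h2.trans (h3.trans (dif_pos m.2))
      simpa [glSymbol] using h4
  rw [← h1, map_zero]
  change e (glSymbol k Q) = 0
  rw [h, map_zero]

theorem hasSymbol_algHom_monomial (N : ℕ) (Φ : GlPoly →ₐ[ℂ] GlAlgebra N)
    (hN : Φ (MvPolynomial.X GlVar.N) = N)
    (hC : ∀ m : ℕ+, Φ (MvPolynomial.X (GlVar.C m)) = glValue glOperator m (finRotate m))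
    (d : GlVar →₀ ℕ) :
    HasSymbol (Φ (MvPolynomial.monomial d 1)) (Finsupp.weight glWeight d)
      (glSymbol N (MvPolynomial.monomial d 1)) := by
  have hX : ∀ v, HasSymbol (Φ (MvPolynomial.X v)) (glWeight v)
      (glSymbol N (MvPolynomial.X v)) := by
    rintro (_ | m)
    · rw [hN, glSymbol, MvPolynomial.aeval_X]; exact HasSymbol.natCast N
    · rw [hC, glSymbol, MvPolynomial.aeval_X]; exact hasSymbol_glValue _
  induction d using Finsupp.induction_linear with
  | zero =>
    rw [map_zero, ← MvPolynomial.C_apply, map_one, map_one, map_one]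
    exact HasSymbol.one
  | add d e hd he =>
    rw [map_add, ← one_mul (1 : ℂ), ← MvPolynomial.monomial_mul, map_mul, map_mul]
    exact hd.mul he
  | single v n =>
    rw [← MvPolynomial.X_pow_eq_monomial, map_pow, map_pow, Finsupp.weight_single, smul_eq_mul]
    exact (hX v).pow n

/-- Monomials of weight below `n` do not reach degree `n` in `t`; those of weight `n` contribute
their symbols. -/
theorem coeff_algHom_apply (N : ℕ) (Φ : GlPoly →ₐ[ℂ] GlAlgebra N)
    (hN : Φ (MvPolynomial.X GlVar.N) = N)
    (hC : ∀ m : ℕ+, Φ (MvPolynomial.X (GlVar.C m)) = glValue glOperator m (finRotate m))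
    (Q : GlPoly) (n : ℕ) (hn : ∀ d ∈ Q.support, Finsupp.weight glWeight d ≤ n) :
    (Φ Q).coeff n = Algebra.lmul ℂ (MatrixPoly (Fin N))
      (glSymbol N (MvPolynomial.weightedHomogeneousComponent glWeight n Q)) := by
  classical
  have hmon : ∀ d, MvPolynomial.monomial d (Q.coeff d) =
      Q.coeff d • MvPolynomial.monomial d (1 : ℂ) := fun d => by
    rw [MvPolynomial.smul_monomial, smul_eq_mul, mul_one]
  conv_lhs => rw [Q.as_sum]
  rw [MvPolynomial.weightedHomogeneousComponent_apply, map_sum, map_sum, map_sum,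
    Polynomial.finsetSum_coeff, Finset.sum_filter]
  refine Finset.sum_congr rfl fun d hd => ?_
  have h := hasSymbol_algHom_monomial N Φ hN hC d
  rw [hmon, map_smul, map_smul, map_smul, Polynomial.coeff_smul]
  split_ifs with hdn
  · rw [← hdn, h.2]
  · rw [Polynomial.coeff_eq_zero_of_natDegree_lt
      (h.1.trans_lt (lt_of_le_of_ne (hn d hd) hdn)), smul_zero]

/-- The values of `glFamily` on the standard cycles satisfy no polynomial relation. -/
theorem injective_of_glFamily (Φ : GlPoly →ₐ[ℂ] ∀ N, GlAlgebra N)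
    (hN : Φ (MvPolynomial.X GlVar.N) = fun N => (N : GlAlgebra N))
    (hC : ∀ m : ℕ+, Φ (MvPolynomial.X (GlVar.C m)) = glFamily m (finRotate m)) :
    Function.Injective Φ := by
  rw [injective_iff_map_eq_zero]
  intro Q hQ
  by_contra hQ0
  -- The component of maximal weight is nonzero, yet its symbol would vanish for every `N`.
  obtain ⟨d, hd, hmax⟩ := Q.support.exists_max_image (Finsupp.weight glWeight)
    (Finset.nonempty_iff_ne_empty.2 (by simpa using hQ0))
  have h0 : MvPolynomial.weightedHomogeneousComponent glWeight (Finsupp.weight glWeight d) Q = 0 := by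
    refine eq_zero_of_glSymbol_eq_zero _ fun N => ?_
    have h := coeff_algHom_apply N ((Pi.evalAlgHom ℂ _ N).comp Φ) (congrFun hN N)
      (fun m => congrFun (hC m) N) Q _ hmax
    rw [AlgHom.comp_apply, hQ, map_zero, Polynomial.coeff_zero] at h
    exact Algebra.lmul_injective (h.symm.trans (map_zero _).symm)
  have h1 := congrArg (MvPolynomial.coeff d) h0
  rw [MvPolynomial.coeff_weightedHomogeneousComponent, if_pos rfl, MvPolynomial.coeff_zero] at h1
  exact MvPolynomial.mem_support_iff.1 hd h1

end Evaluation

/-! ### Existence and uniqueness of the universal weight system -/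

section Universal

/-- An exchange system with values in the polynomial ring `ℂ[N, C₁, C₂, …]`. -/
theorem exists_isExchangeSystem : ∃ w : ∀ m : ℕ, HyperArc m → GlPoly,
    IsExchangeSystem (MvPolynomial.X GlVar.N) w ∧
      ∀ m : ℕ+, w m (finRotate m) = MvPolynomial.X (GlVar.C m) := by
  obtain ⟨Φ, hN, hC⟩ := isExchangeSystem_glFamily.exists_algHom
    fun m α => funext fun N => Nat.cast_comm N _
  have hinj := injective_of_glFamily Φ hN hC
  have hrange : ∀ m (α : HyperArc m), glFamily m α ∈ Φ.range :=
    isExchangeSystem_glFamily.mem_range Φ.range ⟨_, hN⟩ fun n => ⟨_, hC n.succPNat⟩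
  choose w hw using hrange
  have hw' : ∀ m (α : HyperArc m), Φ (w m α) = glFamily m α := hw
  have hc : ∀ (n : ℕ) (p : Fin (n + 1)) (σ : HyperArc (n + 1)),
      Φ (contraction (MvPolynomial.X GlVar.N) w p σ) =
        contraction (fun N => (N : GlAlgebra N)) glFamily p σ := by
    intro n p σ
    unfold contraction
    rw [map_mul, hw', apply_ite Φ, hN, map_one]
  refine ⟨w, ⟨hinj ?_, fun m n α β => hinj ?_, fun n α k => hinj ?_, fun n α p hp => hinj ?_⟩,
    fun m => hinj ?_⟩
  · rw [hw', map_one, isExchangeSystem_glFamily.empty_eq]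
  · rw [map_mul, hw', hw', hw', isExchangeSystem_glFamily.concat_eq]
  · rw [map_sub, map_sub, hw', hw', hc, hc, isExchangeSystem_glFamily.exchange]
  · rw [map_mul, hw', hw', hw', isExchangeSystem_glFamily.fixed_leg n α p hp]
  · rw [hw', hC]

/-- For `a → k + 1 → k → b`, the product has `a → k + 1 → b` with `k` fixed; dropping `k` leaves `a
→ k → b` after renumbering. -/
theorem eraseLeg_castSucc_mul_adjSwap {n : ℕ} (α : HyperArc (n + 2)) (k : Fin (n + 1))
    (h : α k.succ = k.castSucc) :
    eraseLeg k.castSucc (α * adjSwap k) = eraseLeg k.succ α := by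
  ext l : 1
  apply Fin.succAbove_right_injective (p := k.castSucc)
  have hne : α (k.succ.succAbove l) ≠ k.castSucc := fun h' =>
    Fin.succAbove_ne _ _ (α.injective (h'.trans h.symm))
  rw [succAbove_eraseLeg, ← adjSwap_succ_succAbove k (eraseLeg _ _ _), succAbove_eraseLeg,
    Equiv.Perm.mul_apply, adjSwap_castSucc_succAbove, if_neg hne, h]
  split_ifs with h2
  · rw [h2, adjSwap, Equiv.swap_apply_left]
  · rw [adjSwap, Equiv.swap_apply_of_ne_of_ne hne h2]

theorem eraseLeg_eraseLeg_mul_adjSwap {n : ℕ} (α : HyperArc (n + 2)) (k : Fin (n + 1))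
    (h1 : α k.castSucc ≠ k.succ) (h : α k.succ = k.castSucc) :
    eraseLeg k (eraseLeg k.succ (α * adjSwap k)) = eraseLeg k (eraseLeg k.succ α) := by
  set σ := α * adjSwap k with hσ
  have hk : k.succ.succAbove k = k.castSucc := by simp
  have hσk : σ k.castSucc = k.castSucc := by simp [σ, adjSwap, h]
  have hσk' : σ k.succ = α k.castSucc := by simp [σ, adjSwap]
  have hne : k.castSucc ≠ k.succ := by simp [Fin.ext_iff]
  have hfix : eraseLeg k.succ σ k = k := by
    apply Fin.succAbove_right_injective (p := k.succ)
    rw [succAbove_eraseLeg, hk, hσk, if_neg hne]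
  ext l : 1
  have hm : k.succAbove l ≠ k := Fin.succAbove_ne k l
  apply Fin.succAbove_right_injective (p := k)
  rw [succAbove_eraseLeg, succAbove_eraseLeg, if_neg fun h' =>
    hm ((eraseLeg k.succ σ).injective (h'.trans hfix.symm))]
  apply Fin.succAbove_right_injective (p := k.succ)
  have hs : σ (k.succ.succAbove (k.succAbove l)) = α (k.succ.succAbove (k.succAbove l)) := by
    rw [hσ, Equiv.Perm.mul_apply, adjSwap_succ_succAbove, adjSwap_succAbove_of_ne hm]
  have hα : α (k.succ.succAbove (k.succAbove l)) ≠ k.castSucc := fun h' =>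
    Fin.succAbove_ne _ _ (α.injective (h'.trans h.symm))
  have hiff : eraseLeg k.succ α (k.succAbove l) = k ↔
      α (k.succ.succAbove (k.succAbove l)) = k.succ := by
    rw [← (Fin.succAbove_right_injective (p := k.succ)).eq_iff, succAbove_eraseLeg, hk]
    split_ifs with h2
    · simp [h, h2]
    · simp [h2, hα]
  rw [succAbove_eraseLeg, hs, hσk']
  split_ifs with h2 h3 h3
  · rw [succAbove_eraseLeg, hk, if_neg h1]
  · exact absurd (hiff.2 h2) h3
  · exact absurd (hiff.1 h3) h2
  · rw [succAbove_eraseLeg, if_neg h2]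

theorem IsExchangeSystem.isUniversalGlWeightSystem {w : ∀ m : ℕ, HyperArc m → GlPoly}
    (hw : IsExchangeSystem (MvPolynomial.X GlVar.N) w)
    (hC : ∀ m : ℕ+, w m (finRotate m) = MvPolynomial.X (GlVar.C m)) :
    IsUniversalGlWeightSystem w where
  concat_eq := hw.concat_eq
  cycle_eq := hC
  recurrence n α k h1 h2 := by
    have h3 : (α * adjSwap k) k.succ ≠ k.succ := by simpa [adjSwap] using h1
    have h4 : (α * adjSwap k) k.castSucc ≠ k.castSucc := by simpa [adjSwap] using h2
    rw [hw.exchange, contraction, contraction, if_neg h3, if_neg h4, one_mul, one_mul]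
  recurrence_exceptional n α k h1 h2 := by
    have h3 : (α * adjSwap k) k.succ ≠ k.succ := by simpa [adjSwap] using h1
    have h4 : (α * adjSwap k) k.castSucc = k.castSucc := by simpa [adjSwap] using h2
    have h5 : eraseLeg k.succ (α * adjSwap k) k = k := by
      apply Fin.succAbove_right_injective (p := k.succ)
      rw [succAbove_eraseLeg, show k.succ.succAbove k = k.castSucc by simp, h4, if_neg]
      simp [Fin.ext_iff]
    have h6 : w 1 1 = MvPolynomial.X (GlVar.C 1) := by
      rw [← hC 1]
      exact congrArg (w 1) finRotate_one.symm
    rw [hw.exchange, contraction, contraction, if_neg h3, if_pos h4, one_mul,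
      hw.fixed_leg _ _ k h5, eraseLeg_castSucc_mul_adjSwap α k h2,
      eraseLeg_eraseLeg_mul_adjSwap α k h1 h2, h6]

/-- Appending the empty diagram to the one-leg diagram gives `C₁ = C₁ * w 0 1`, and `C₁` can be
cancelled. -/
theorem IsUniversalGlWeightSystem.empty_eq {w : ∀ m : ℕ, HyperArc m → GlPoly}
    (hw : IsUniversalGlWeightSystem w) : w 0 1 = 1 := by
  have h := hw.concat_eq 1 0 (finRotate 1) 1
  have h1 : w 1 (finRotate 1) = MvPolynomial.X (GlVar.C 1) := hw.cycle_eq 1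
  rw [show concat (finRotate 1) (1 : HyperArc 0) = finRotate 1 from
    Subsingleton.elim (α := Equiv.Perm (Fin 1)) _ _] at h
  change w 1 (finRotate 1) = _ at h
  rw [h1] at h
  exact (mul_eq_left₀ (MvPolynomial.X_ne_zero _)).1 h.symm

theorem IsUniversalGlWeightSystem.unique {w w' : ∀ m : ℕ, HyperArc m → GlPoly}
    (hw : IsUniversalGlWeightSystem w) (hw' : IsUniversalGlWeightSystem w') : w' = w := by
  have hexc : ∀ (n : ℕ) (α : HyperArc (n + 2)) (k : Fin (n + 1)),
      (∀ m < n + 2, ∀ β : HyperArc m, w' m β = w m β) →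
      α k.castSucc ≠ k.succ → α k.succ = k.castSucc →
      w' (n + 2) α - w' (n + 2) (adjSwap k * α * adjSwap k) =
        w (n + 2) α - w (n + 2) (adjSwap k * α * adjSwap k) := by
    intro n α k ih h1 h2
    rw [hw.recurrence_exceptional n α k h1 h2, hw'.recurrence_exceptional n α k h1 h2,
      ih n (by omega), ih (n + 1) (by omega)]
  funext m α
  refine hyperArc_induction (P := fun m α => w' m α = w m α) ?_ ?_ ?_ ?_ m α
  · rw [hw.empty_eq, hw'.empty_eq]
  · intro n
    exact (hw'.cycle_eq n.succPNat).trans (hw.cycle_eq n.succPNat).symm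
  · intro m n α β hα hβ
    rw [hw.concat_eq, hw'.concat_eq, hα, hβ]
  · intro n α k ih hα
    have hl : adjSwap k k.castSucc = k.succ := Equiv.swap_apply_left _ _
    have hr : adjSwap k k.succ = k.castSucc := Equiv.swap_apply_right _ _
    by_cases h1 : α k.castSucc = k.succ
    · by_cases h2 : α k.succ = k.castSucc
      · have : adjSwap k * α * adjSwap k = α := by
          rw [mul_assoc, adjSwap, Equiv.mul_swap_eq_swap_mul, h1, h2, Equiv.swap_comm k.succ,
            ← mul_assoc, Equiv.swap_mul_self, one_mul]
        rwa [this]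
      -- A lone arc `k → k + 1` is reversed by the exchange, so the exceptional relation applies to
      -- the exchanged diagram.
      · have h := hexc n (adjSwap k * α * adjSwap k) k ih
          (by
            simp only [Equiv.Perm.mul_apply, hl]
            exact fun h' => h2 ((adjSwap k).injective (h'.trans hl.symm)))
          (by simp only [Equiv.Perm.mul_apply, hr, h1])
        have h3 : adjSwap k * (adjSwap k * α * adjSwap k) * adjSwap k = α := by
          rw [mul_assoc, mul_assoc, adjSwap_mul_self, mul_one, ← mul_assoc, adjSwap_mul_self,
            one_mul]
        rw [h3, hα] at h
        exact sub_left_injective h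
    · have h : w' (n + 2) α - w' (n + 2) (adjSwap k * α * adjSwap k) =
          w (n + 2) α - w (n + 2) (adjSwap k * α * adjSwap k) := by
        by_cases h2 : α k.succ = k.castSucc
        · exact hexc n α k ih h1 h2
        · rw [hw.recurrence n α k h1 h2, hw'.recurrence n α k h1 h2, ih _ (by omega),
            ih _ (by omega)]
      rw [hα] at h
      exact sub_right_injective h

end Universal

end HyperDiagram

theorem mainTheorem1 :
    ∃ w : ∀ m : ℕ, HyperDiagram.HyperArc m → HyperDiagram.GlPoly,
      -- `w` is the universal `gl`-weight system
      HyperDiagram.IsUniversalGlWeightSystem w ∧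
      (∀ w' : ∀ m : ℕ, HyperDiagram.HyperArc m → HyperDiagram.GlPoly,
        HyperDiagram.IsUniversalGlWeightSystem w' → w' = w) ∧
      -- it is a function on hyper chord diagrams
      (∃ v : ∀ m : ℕ, HyperDiagram.HyperChord m → HyperDiagram.GlPoly,
        ∀ (m : ℕ) (α : HyperDiagram.HyperArc m), v m α.toChord = w m α) ∧
      -- it satisfies the generalized Vassiliev relations
      HyperDiagram.OneHyperArcRelations w ∧
      HyperDiagram.TwoHyperArcRelations w := by
  obtain ⟨w, hw, hC⟩ := HyperDiagram.exists_isExchangeSystem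
  have hu := hw.isUniversalGlWeightSystem hC
  refine ⟨w, hu, fun w' hw' => hu.unique hw', ⟨fun m => Quotient.lift (w m) ?_, fun m α => rfl⟩,
    hw.oneHyperArcRelations, hw.twoHyperArcRelations⟩
  rintro α β ⟨i, rfl⟩
  exact (hw.rotate_zpow α i).symm
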